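/- **Setting.** Let $C/F$ be a finite cyclic Galois field extension of degree $n$, let $E/C$ be a finite cyclic Galois field extension of degree $d$ with ${\rm Gal}(E/C)=\langle\gamma\rangle$, and let $A=(E/C,\gamma,a)$, $a\in C^\times$, be the cyclic algebra of degree $d$ over $C$, i.e. $A=\bigoplus_{i=0}^{d-1}E e^i$ with $ez=\gamma(z)e$ for $z\in E$ and $e^d=a$. Let $\sigma$ be a ring automorphism of $A$ that restricts to a generator of ${\rm Gal}(C/F)$, and let $u\in A^\times$ satisfy $\sigma(u)=u$ and $\sigma^n(z)=uzu^{-1}$ for all $z\in A$. Assume that $\sigma(E)=E$, that $\gamma\circ\sigma|_E=\sigma|_E\circ\gamma$, and that $u\in E$. Let $R=A[t;\sigma]$ be the twisted polynomial ring, with $tb=\sigma(b)t$ for $b\in A$. Its center is $F[x]$ with $x=u^{-1}t^n$. Let $A(t;\sigma)=\{f/g : f\in R,\ 0\ne g\in F[x]\}$ be its ring of central quotients, a central simple algebra over $F(x)$, and let $N:A(t;\sigma)\to F(x)$ be its reduced norm. For $f\in R$, write $(f,t)_r=1$ if every common right divisor of $f$ and $t$ in $R$ is a unit. Let $\hat h\in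 F[x]$ be the monic polynomial of least degree such that $\hat h(u^{-1}t^n)=gf$ for some $g\in R$ (so $h(t)=\hat h(u^{-1}t^n)$ is the minimal central left multiple of $f$). An element of $R$ is called irreducible if it is not a unit and is not a product of two non-units. **Theorem.** Let $f\in R$ have degree $m$ in $t$, with $(f,t)_r=1$, and suppose that $\hat h$ has degree $dm$ in $x$. (i) If $\hat h$ is irreducible in $F[x]$, then $f$ is irreducible in $R$. (ii) If $f$ is irreducible in $R$, then $N(f)$ lies in $F[x]$ and is irreducible in $F[x]$. -/

import Mathlib

open scoped TensorProduct Polynomial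

noncomputable section

/-! ### Reduced norms -/

/-- `c` is the reduced norm of `b`, computed by splitting the `K`-algebra `B` over the algebraic
closure of `K`: it is the determinant of the image of `1 ⊗ b` in a matrix algebra.
By the Skolem-Noether theorem this does not depend on the splitting. -/
def IsReducedNorm (K : Type*) {B : Type*} [Field K] [Ring B] [Algebra K B] (b : B) (c : K) :
    Prop :=
  ∃ (r : ℕ) (φ : (AlgebraicClosure K ⊗[K] B) ≃ₐ[AlgebraicClosure K]
      Matrix (Fin r) (Fin r) (AlgebraicClosure K)),
    (φ (1 ⊗ₜ[K] b)).det = algebraMap K (AlgebraicClosure K) c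

open Classical in
/-- The reduced norm `B → K` of a central simple `K`-algebra `B`
(with value `0` where there is none, which does not happen for central simple algebras). -/
def reducedNorm (K : Type*) {B : Type*} [Field K] [Ring B] [Algebra K B] (b : B) : K :=
  if h : ∃ c : K, IsReducedNorm K b c then h.choose else 0

/-! ### Cyclic algebras -/

/-- A presentation of the `C`-algebra `A` as the cyclic algebra `(E/C, γ, a)`: `E/C` is a finite
cyclic Galois extension with group generated by `γ`, `a` is a nonzero element of `C`, and
`A = E ⊕ E e ⊕ ⋯ ⊕ E e ^ (d - 1)` with `e z = γ(z) e` for `z ∈ E` and `e ^ d = a`,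
where `d = [E : C]`. -/
structure CyclicAlgebra (C E A : Type*) [Field C] [Field E] [Ring A] [Algebra C E] [Algebra C A]
    [FiniteDimensional C E] [IsGalois C E] where
  γ : E ≃ₐ[C] E
  γ_generates : ∀ g : E ≃ₐ[C] E, g ∈ Subgroup.zpowers γ
  a : C
  a_ne_zero : a ≠ 0
  /-- the embedding of `E` into `A` -/
  ι : E →ₐ[C] A
  e : A
  e_mul : ∀ z : E, e * ι z = ι (γ z) * e
  e_pow : e ^ Module.finrank C E = algebraMap C A a
  existsUnique_repr : ∀ y : A, ∃! z : Fin (Module.finrank C E) → E,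
    y = ∑ i, ι (z i) * e ^ (i : ℕ)

/-! ### Twisted polynomial rings -/

/-- The data defining `A[t; σ]` with its central element `x = u⁻¹ tⁿ`: a finite cyclic Galois
extension `C/F` of degree `n`, a ring automorphism `σ` of the `C`-algebra `A` that restricts to a
generator of `Gal(C/F)`, and a unit `u` of `A` with `σⁿ(z) = u z u⁻¹` for all `z` and
`σ(u) = u`. -/
structure TwistedData (F C A : Type*) [Field F] [Field C] [Ring A] [Algebra F C] [Algebra C A]
    [FiniteDimensional F C] [IsGalois F C] where
  σ : A ≃+* A
  /-- the restriction of `σ` to `C` -/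
  σC : C ≃ₐ[F] C
  σ_algebraMap : ∀ c : C, σ (algebraMap C A c) = algebraMap C A (σC c)
  σC_generates : ∀ g : C ≃ₐ[F] C, g ∈ Subgroup.zpowers σC
  u : Aˣ
  σ_pow : ∀ z : A, (σ ^ Module.finrank F C) z = u * z * (u⁻¹ : Aˣ)
  σ_u : σ u = u

namespace TwistedData

variable {F C A : Type*} [Field F] [Field C] [Ring A] [Algebra F C] [Algebra C A]
  [FiniteDimensional F C] [IsGalois F C]

/-- The action of `ℕ` on `A` through the powers of `σ`. -/
abbrev action (S : TwistedData F C A) : MulSemiringAction (Multiplicative ℕ) A :=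
  MulSemiringAction.compHom A (powersHom (RingAut A) S.σ)

/-- The twisted polynomial ring `R = A[t; σ]`, with `t a = σ(a) t`. -/
def SkewRing (_S : TwistedData F C A) : Type _ := SkewPolynomial A

variable (S : TwistedData F C A)

instance : Ring S.SkewRing :=
  letI := S.action
  inferInstanceAs (Ring (SkewPolynomial A))

/-- The embedding of `A` into `A[t; σ]` as constant polynomials. -/
def const : A →+* S.SkewRing :=
  letI := S.action
  SkewPolynomial.CRingHom (R := A)

/-- The indeterminate `t`. -/
def t : S.SkewRing := SkewPolynomial.X (R := A)

/-- The coefficient `a_i` of `f = ∑ a_i t^i`. -/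
def coeff (f : S.SkewRing) (i : ℕ) : A := SkewPolynomial.coeff (R := A) f i

/-- `f` has degree `m`. -/
def HasDegree (f : S.SkewRing) (m : ℕ) : Prop :=
  S.coeff f m ≠ 0 ∧ ∀ i, m < i → S.coeff f i = 0

/-- The central element `x = u⁻¹ tⁿ`. -/
def x : S.SkewRing := S.const ((S.u⁻¹ : Aˣ) : A) * S.t ^ Module.finrank F C

/-- The embedding of `F` into `A[t; σ]`. -/
def scalar : F →+* S.SkewRing :=
  S.const.comp ((algebraMap C A).comp (algebraMap F C))

theorem t_mul_const (b : A) : S.t * S.const b = S.const (S.σ b) * S.t := by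
  let := S.action
  have h := SkewPolynomial.X_mul_monomial (R := A) 0 b
  rw [← SkewPolynomial.C_mul_X_eq_monomial] at h
  exact h

theorem t_pow_mul_const (k : ℕ) (b : A) :
    S.t ^ k * S.const b = S.const ((S.σ ^ k) b) * S.t ^ k := by
  induction k generalizing b with
  | zero => simp
  | succ k ih =>
    rw [pow_succ, mul_assoc, t_mul_const, ← mul_assoc, ih, mul_assoc, pow_succ]
    rfl

theorem eq_sum (f : S.SkewRing) :
    ∃ s : Finset ℕ, f = ∑ i ∈ s, S.const (S.coeff f i) * S.t ^ i := by
  let := S.action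
  refine ⟨SkewPolynomial.support (R := A) f, ?_⟩
  have h : SkewPolynomial.sum (R := A) f (fun a => SkewPolynomial.monomial a) = f :=
    SkewPolynomial.sum_monomial (R := A) f
  refine h.symm.trans ((SkewPolynomial.sum_def (R := A) f _).trans
    (Finset.sum_congr rfl fun i _ => ?_))
  exact Eq.symm (SkewPolynomial.C_mul_X_pow_eq_monomial (R := A) (n := i))

theorem commute_of_generators {y : S.SkewRing} (hc : ∀ b, Commute y (S.const b))
    (ht : Commute y S.t) (f : S.SkewRing) : Commute y f := by
  obtain ⟨s, hs⟩ := S.eq_sum f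
  rw [hs]
  exact Commute.sum_right _ _ _ fun i _ => (hc _).mul_right (ht.pow_right _)

theorem x_commute (f : S.SkewRing) : Commute S.x f := by
  refine S.commute_of_generators (fun b => ?_) ?_ f
  · unfold x Commute SemiconjBy
    rw [mul_assoc, t_pow_mul_const, S.σ_pow, ← mul_assoc, ← map_mul]
    rw [mul_assoc (S.u : A), Units.inv_mul_cancel_left, map_mul, mul_assoc]
  · have hu : S.σ ((S.u⁻¹ : Aˣ) : A) = ((S.u⁻¹ : Aˣ) : A) := by
      have h : S.σ ((S.u⁻¹ : Aˣ) : A) * (S.u : A) = 1 := by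
        conv_lhs => rw [← S.σ_u]
        rw [← map_mul, Units.inv_mul, map_one]
      calc S.σ ((S.u⁻¹ : Aˣ) : A)
          = S.σ ((S.u⁻¹ : Aˣ) : A) * (S.u : A) * ((S.u⁻¹ : Aˣ) : A) := by
            rw [mul_assoc, Units.mul_inv, mul_one]
        _ = _ := by rw [h, one_mul]
    unfold x Commute SemiconjBy
    rw [mul_assoc, ← pow_succ, ← mul_assoc, t_mul_const, hu, mul_assoc, ← pow_succ']

theorem scalar_commute (c : F) (f : S.SkewRing) : Commute (S.scalar c) f := by
  refine S.commute_of_generators (fun b => ?_) ?_ f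
  · exact Commute.map (Algebra.commutes (algebraMap F C c) b) S.const
  · have h := S.t_mul_const (algebraMap C A (algebraMap F C c))
    rw [S.σ_algebraMap, AlgEquiv.commutes] at h
    exact h.symm

/-- The embedding `p ↦ p(u⁻¹ tⁿ)` of the polynomial ring `F[x]` onto the center of `A[t; σ]`. -/
def ofCenter : F[X] →+* S.SkewRing :=
  Polynomial.eval₂RingHom' S.scalar S.x fun c => S.scalar_commute c S.x

theorem ofCenter_commute (p : F[X]) (f : S.SkewRing) : Commute (S.ofCenter p) f := by
  induction p using Polynomial.induction_on' with
  | add p q hp hq => rw [map_add]; exact hp.add_left hq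
  | monomial k c =>
    have h : S.ofCenter (Polynomial.monomial k c) = S.scalar c * S.x ^ k :=
      Polynomial.eval₂_monomial _ _
    rw [h]
    exact (S.scalar_commute c f).mul_left ((S.x_commute f).pow_left k)

/-- `A[t; σ]` as an algebra over `F[x]`, where `x = u⁻¹ tⁿ`. -/
instance : Algebra F[X] S.SkewRing :=
  S.ofCenter.toAlgebra' fun p f => S.ofCenter_commute p f

/-- The ring of central quotients `A(t; σ)`, i.e. the localization of `A[t; σ]` at the nonzero
elements of `F[x]`, where `x = u⁻¹ tⁿ`; it is an algebra over `F(x)`. -/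
abbrev CentralQuotients : Type _ := FractionRing F[X] ⊗[F[X]] S.SkewRing

/-- `N(f)` for `f ∈ A[t; σ]`, where `N` is the reduced norm of `A(t; σ)` over `F(x)`. -/
def norm (f : S.SkewRing) : FractionRing F[X] :=
  reducedNorm (FractionRing F[X]) ((1 : FractionRing F[X]) ⊗ₜ[F[X]] f : S.CentralQuotients)

/-- `(f, t)_r = 1`: every common right divisor of `f` and `t` is a unit. -/
def RightCoprimeT (f : S.SkewRing) : Prop :=
  ∀ g : S.SkewRing, (∃ p, f = p * g) → (∃ q, S.t = q * g) → IsUnit g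

/-- `h(u⁻¹ tⁿ)` is the minimal central left multiple of `f`, where `h ∈ F[x]` is monic. -/
structure IsMinCentralLeftMultiple (f : S.SkewRing) (h : F[X]) : Prop where
  monic : h.Monic
  left_multiple : ∃ g : S.SkewRing, S.ofCenter h = g * f
  minimal : ∀ p : F[X], p.Monic → (∃ g : S.SkewRing, S.ofCenter p = g * f) →
    h.natDegree ≤ p.natDegree

end TwistedData

end

/-! The degree hypothesis forces the minimal central left multiple h of f to agree with N(f) up to a
unit of F[x]. Both claims then follow by comparing factorizations of f, of N(f) and of h.

As a right E[x]-module, R is free on the dn monomials e^k t^i, so left multiplication represents R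
by matrices over E[x] (`rho`). Right multiplication by a basis element intertwines this
representation with a Galois twist of itself, so its determinant is Galois invariant and descends to
a multiplicative map R → F[x] (`nrm`). After extension of scalars the representation becomes an
isomorphism onto a full matrix algebra, so `nrm` is the reduced norm (`reducedNorm_eq`). By
Cayley-Hamilton, N(f) is a left multiple of f (`exists_adjoint`). Hence h divides N(f), and f is a
unit exactly when N(f) is (`isUnit_iff`). Counting t-degrees gives deg N(f) ≤ dm
(`natDegree_nrm_le`), so h and N(f) are associated.

For (i), a factorization of f gives one of N(f), and the norm detects units. For (ii), left ideals
of R are principal (`exists_generator`). If h = pq, a generator of Rf + Rp is a right divisor of the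
irreducible f: either it is a unit multiple of f, and h divides p, or it is a unit, and h divides q
(`irreducible_of_irreducible`). -/

open scoped TensorProduct Polynomial

attribute [local instance] Polynomial.algebra

/-! ### Crossed product orders and their regular representation -/

/-- A ring `R` over `F[X]` which is, like an order in a crossed product algebra, free as a right
module over `E[X]` on elements `v i` that induce pairwise distinct automorphisms of `E/F`. -/
structure CrossedOrder (F E R I : Type*) [Field F] [Field E] [Algebra F E] [Ring R]
    [Algebra F[X] R] [Fintype I] where
  j : E[X] →+* R
  j_map : ∀ p : F[X], j (p.map (algebraMap F E)) = algebraMap F[X] R p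
  v : I → R
  g : I → (E ≃ₐ[F] E)
  g_injective : Function.Injective g
  j_mul_v : ∀ i w, j w * v i = v i * j (w.map (g i : E →+* E))
  bijective : Function.Bijective fun c : I → E[X] => ∑ i, v i * j (c i)
  -- This and the next field replace invertibility of `v i`, which fails for positive powers of t.
  exists_mul_v : ∀ i, ∃ b, ∃ y : E[X], y ≠ 0 ∧ b * v i = j y
  eq_zero_of_mul_v : ∀ i b, b * v i = 0 → b = 0
  card_eq : Fintype.card I = Module.finrank F E

namespace CrossedOrder

variable {F E R I : Type*} [Field F] [Field E] [Algebra F E] [Ring R]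
    [Algebra F[X] R] [Fintype I] (O : CrossedOrder F E R I)

/-- Linear combinations of the basis `v`. -/
noncomputable def comb : (I → E[X]) →ₗ[F[X]] R where
  toFun c := ∑ i, O.v i * O.j (c i)
  map_add' c c' := by simp [mul_add, Finset.sum_add_distrib]
  map_smul' p c := by
    rw [RingHom.id_apply, Algebra.smul_def p (∑ i, _), Finset.mul_sum]
    refine Finset.sum_congr rfl fun i _ => ?_
    rw [Pi.smul_apply, Algebra.smul_def, map_mul, ← mul_assoc, ← mul_assoc, Algebra.commutes p]
    exact congrArg (fun z => O.v i * z * O.j (c i)) (O.j_map p)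

/-- The coordinates in the basis `v`. -/
noncomputable def coord : R ≃ₗ[F[X]] (I → E[X]) :=
  (LinearEquiv.ofBijective O.comb O.bijective).symm

theorem sum_coord (b : R) : ∑ i, O.v i * O.j (O.coord b i) = b :=
  (LinearEquiv.ofBijective O.comb O.bijective).apply_symm_apply b

theorem coord_eq {b : R} {c : I → E[X]} (h : ∑ i, O.v i * O.j (c i) = b) : O.coord b = c := by
  rw [← h]
  exact (LinearEquiv.ofBijective O.comb O.bijective).symm_apply_apply c

theorem ext_coord {c c' : I → E[X]} (h : ∑ i, O.v i * O.j (c i) = ∑ i, O.v i * O.j (c' i)) :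
    c = c' := O.bijective.1 h

theorem coord_mul_j (b : R) (w : E[X]) (i : I) : O.coord (b * O.j w) i = O.coord b i * w := by
  rw [O.coord_eq (c := fun i => O.coord b i * w)]
  conv_rhs => rw [← O.sum_coord b]
  simp [Finset.sum_mul, mul_assoc]

theorem isGalois [FiniteDimensional F E] (O : CrossedOrder F E R I) : IsGalois F E := by
  refine IsGalois.of_card_aut_eq_finrank F E (le_antisymm ?_ ?_)
  · rw [Nat.card_eq_fintype_card]; exact AlgEquiv.card_le
  · rw [← O.card_eq, Nat.card_eq_fintype_card]
    exact Fintype.card_le_of_injective _ O.g_injective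

theorem g_bijective [FiniteDimensional F E] : Function.Bijective O.g := by
  have := O.isGalois
  rw [Fintype.bijective_iff_injective_and_card]
  refine ⟨O.g_injective, ?_⟩
  rw [O.card_eq, ← Nat.card_eq_fintype_card, IsGalois.card_aut_eq_finrank]

theorem mem_range_of_fixed [FiniteDimensional F E] {w : E[X]} (h : ∀ i, w.map (O.g i : E →+* E) = w) :
    w ∈ (algebraMap F[X] E[X]).range := by
  have := O.isGalois
  refine (Polynomial.mem_map_range (algebraMap F E)).2 fun k => ?_
  have := (IsGalois.mem_range_algebraMap_iff_fixed (F := F) (w.coeff k)).2 fun τ => by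
    obtain ⟨i, rfl⟩ := O.g_bijective.2 τ
    conv_rhs => rw [← h i]
    simp
  exact this

theorem algebraMap_injective {F E : Type*} [Field F] [Field E] [Algebra F E] :
    Function.Injective (algebraMap F[X] E[X]) :=
  Polynomial.map_injective _ (algebraMap F E).injective

variable [DecidableEq I]

theorem coord_v (k : I) : O.coord (O.v k) = Pi.single k 1 := by
  refine O.coord_eq ?_
  rw [Finset.sum_eq_single k]
  · simp
  · intro i _ hi; simp [hi]
  · simp

/-- Left multiplication as a matrix with entries in `E[X]`. -/
noncomputable def rho : R →ₐ[F[X]] Matrix I I E[X] where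
  toFun b := Matrix.of fun l k => O.coord (b * O.v k) l
  map_one' := by
    ext l k
    simp [coord_v, Matrix.one_apply, Pi.single_apply]
  map_mul' a b := by
    ext1 l k
    rw [Matrix.mul_apply]
    simp only [Matrix.of_apply]
    have h : a * b * O.v k = ∑ q, a * O.v q * O.j (O.coord (b * O.v k) q) := by
      conv_lhs => rw [mul_assoc, ← O.sum_coord (b * O.v k)]
      simp [Finset.mul_sum, mul_assoc]
    rw [h, map_sum, Finset.sum_apply]
    simp [coord_mul_j]
  map_zero' := by ext1 l k; simp
  map_add' a b := by ext1 l k; simp [add_mul]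
  commutes' p := by
    ext1 l k
    rw [Matrix.of_apply, ← Algebra.smul_def, map_smul, coord_v, Matrix.algebraMap_matrix_apply,
      Pi.smul_apply, Pi.single_apply]
    split_ifs <;> simp [Algebra.smul_def]

theorem mul_v (b : R) (k : I) : b * O.v k = ∑ l, O.v l * O.j (O.rho b l k) :=
  (O.sum_coord _).symm

theorem rho_injective : Function.Injective O.rho := by
  rw [injective_iff_map_eq_zero]
  intro b hb
  have h : ∀ k, b * O.v k = 0 := fun k => by rw [O.mul_v, hb]; simp
  rw [← mul_one b, ← O.sum_coord 1, Finset.mul_sum]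
  exact Finset.sum_eq_zero fun i _ => by rw [← mul_assoc, h, zero_mul]

/-- Right multiplication by `v i` commutes with left multiplication by `b` and is semilinear for `g
i`. Both sides are coordinates of `b * (v k * v i)`, bracketed in the two ways. -/
theorem rho_mul_rho (b : R) (i : I) :
    O.rho b * Matrix.of (fun l k => O.coord (O.v k * O.v i) l) =
      Matrix.of (fun l k => O.coord (O.v k * O.v i) l) *
        (O.rho b).map (Polynomial.map (O.g i : E →+* E)) := by
  ext1 l k
  rw [Matrix.mul_apply, Matrix.mul_apply]
  have h1 : O.coord (b * (O.v k * O.v i)) l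
      = ∑ q, O.rho b l q * O.coord (O.v k * O.v i) q := by
    conv_lhs => rw [← O.sum_coord (O.v k * O.v i)]
    rw [Finset.mul_sum, map_sum, Finset.sum_apply]
    refine Finset.sum_congr rfl fun q _ => ?_
    rw [← mul_assoc, coord_mul_j]; rfl
  have h2 : O.coord (b * (O.v k * O.v i)) l
      = ∑ q, O.coord (O.v q * O.v i) l * (O.rho b q k).map (O.g i : E →+* E) := by
    rw [← mul_assoc, O.mul_v b k, Finset.sum_mul, map_sum, Finset.sum_apply]
    refine Finset.sum_congr rfl fun q _ => ?_
    rw [mul_assoc, O.j_mul_v, ← mul_assoc, coord_mul_j]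
  exact h1.symm.trans h2

/-- A kernel vector, with its entries twisted back by the inverse of `g i`, gives a nonzero element
of `R` annihilated by right multiplication by `v i`. -/
theorem det_ne_zero (i : I) : (Matrix.of (fun l k => O.coord (O.v k * O.v i) l)).det ≠ 0 := by
  intro h0
  obtain ⟨w, hw, hw0⟩ := Matrix.exists_mulVec_eq_zero_iff.2 h0
  apply hw
  have h1 : ∀ k, (w k) = ((w k).map ((O.g i).symm : E →+* E)).map (O.g i : E →+* E) := fun k => by
    rw [Polynomial.map_map]
    conv_lhs => rw [← Polynomial.map_id (p := w k)]
    congr 1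
    ext z; simp
  have h2 : ∑ k, O.v k * O.j ((w k).map ((O.g i).symm : E →+* E)) = 0 := by
    apply O.eq_zero_of_mul_v i
    rw [Finset.sum_mul]
    apply O.coord.injective
    rw [map_sum, map_zero]
    rw [← hw0]
    funext l
    rw [Finset.sum_apply, Matrix.mulVec, dotProduct]
    refine Finset.sum_congr rfl fun k _ => ?_
    rw [mul_assoc, O.j_mul_v, ← h1, ← mul_assoc, coord_mul_j]; rfl
  have h3 := O.ext_coord (c' := 0) (h2.trans (by simp))
  funext k
  rw [h1 k]
  have := congrFun h3 k
  simp only [Pi.zero_apply] at this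
  rw [this]; simp

/-- The intertwiner `P` is invertible only over the fraction field, so the conjugation is written as
an identity of matrix products and `det P` is cancelled afterwards. -/
theorem charpoly_map (b : R) (i : I) :
    (O.rho b).charpoly.map (Polynomial.mapRingHom (O.g i : E →+* E)) = (O.rho b).charpoly := by
  have hc := O.rho_mul_rho b i
  have hd := O.det_ne_zero i
  set P : Matrix I I E[X] := Matrix.of (fun l k => O.coord (O.v k * O.v i) l)
  set M := O.rho b
  rw [← Matrix.charpoly_map]
  have hP : (Polynomial.C (R := E[X])).mapMatrix P * (M.map (Polynomial.mapRingHom (O.g i : E →+* E))).charmatrix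
      = M.charmatrix * (Polynomial.C (R := E[X])).mapMatrix P := by
    simp only [Matrix.charmatrix, mul_sub, sub_mul]
    rw [← map_mul, ← map_mul, hc, ((Matrix.scalar_commute (Polynomial.X) (fun r => by exact Commute.all _ _) _).eq : _)]
    rfl
  have h := congrArg Matrix.det hP
  rw [Matrix.det_mul, Matrix.det_mul, mul_comm] at h
  refine mul_right_cancel₀ ?_ h
  rw [← RingHom.map_det]
  simpa using hd

/-! ### Descent of characteristic polynomial and norm to `F[X]` -/

section Descent

variable [FiniteDimensional F E]

theorem exists_charpoly (b : R) :
    ∃ χ : F[X][X], χ.map (algebraMap F[X] E[X]) = (O.rho b).charpoly := by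
  refine (Polynomial.mem_map_range (algebraMap F[X] E[X])).2 fun k => ?_
  refine O.mem_range_of_fixed fun i => ?_
  conv_rhs => rw [← O.charpoly_map b i]
  simp

theorem exists_det (b : R) : ∃ p : F[X], algebraMap F[X] E[X] p = (O.rho b).det := by
  obtain ⟨χ, hχ⟩ := O.exists_charpoly b
  refine ⟨(-1) ^ Fintype.card I * χ.coeff 0, ?_⟩
  rw [Matrix.det_eq_sign_charpoly_coeff, ← hχ]
  simp

/-- The reduced norm of `R` over `F[X]`. -/
noncomputable def nrm : R →* F[X] where
  toFun b := (O.exists_det b).choose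
  map_one' := algebraMap_injective (E := E) <| by
    rw [(O.exists_det 1).choose_spec]; simp
  map_mul' a b := algebraMap_injective (E := E) <| by
    rw [(O.exists_det (a * b)).choose_spec, map_mul, map_mul, (O.exists_det a).choose_spec,
      (O.exists_det b).choose_spec, Matrix.det_mul]

theorem algebraMap_nrm (b : R) : algebraMap F[X] E[X] (O.nrm b) = (O.rho b).det :=
  (O.exists_det b).choose_spec

theorem nrm_algebraMap (p : F[X]) : O.nrm (algebraMap F[X] R p) = p ^ Fintype.card I := by
  apply algebraMap_injective (E := E)
  rw [algebraMap_nrm, AlgHom.commutes, Matrix.algebraMap_eq_diagonal, Matrix.det_diagonal]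
  simp

/-- The descended characteristic polynomial annihilates `b`, because `rho` is faithful. Its constant
term is the norm up to sign and the rest is divisible by `b`. The cofactor is a polynomial in `b`,
hence commutes with it. -/
theorem exists_adjoint (b : R) :
    ∃ a, a * b = algebraMap F[X] R (O.nrm b) ∧ b * a = algebraMap F[X] R (O.nrm b) := by
  obtain ⟨χ, hχ⟩ := O.exists_charpoly b
  have h0 : Polynomial.aeval b χ = 0 := by
    apply O.rho_injective
    rw [← Polynomial.aeval_algHom_apply, map_zero, ← Polynomial.aeval_map_algebraMap E[X], hχ]
    exact Matrix.aeval_self_charpoly _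
  have h1 : O.nrm b = (-1) ^ Fintype.card I * χ.coeff 0 := by
    apply algebraMap_injective (E := E)
    rw [algebraMap_nrm, Matrix.det_eq_sign_charpoly_coeff, ← hχ]
    simp
  have h2 : Polynomial.aeval b χ.divX * b = - algebraMap F[X] R (χ.coeff 0) := by
    rw [eq_neg_iff_add_eq_zero]
    conv_rhs => rw [← h0, ← Polynomial.divX_mul_X_add χ]
    simp
  have hc : Commute (Polynomial.aeval b χ.divX) b := by
    simpa using (Commute.all χ.divX Polynomial.X).map (Polynomial.aeval (R := F[X]) b)
  have h3 : (-(-1) ^ Fintype.card I * Polynomial.aeval b χ.divX) * b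
      = algebraMap F[X] R (O.nrm b) := by
    rw [mul_assoc, h2, h1]; simp
  refine ⟨_, h3, ?_⟩
  rw [← h3]
  refine Commute.eq (Commute.mul_right ?_ hc.symm)
  exact ((Commute.neg_one_right b).pow_right _).neg_right

theorem isUnit_iff (b : R) : IsUnit b ↔ IsUnit (O.nrm b) := by
  refine ⟨fun h => h.map O.nrm, fun h => ?_⟩
  obtain ⟨a, h1, h2⟩ := O.exists_adjoint b
  have hu := h.map (algebraMap F[X] R)
  obtain ⟨c, hc⟩ := hu
  rw [← hc] at h1 h2
  exact isUnit_iff_exists_and_exists.2 ⟨⟨a * ↑c⁻¹, by rw [← mul_assoc, h2, Units.mul_inv]⟩,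
    ⟨↑c⁻¹ * a, by rw [mul_assoc, h1, Units.inv_mul]⟩⟩

end Descent
end CrossedOrder

/-! ### Splitting and comparison with the reduced norm -/

/-- Dedekind independence of characters: a functional vanishing on all vectors (τ_i(b))_i is a
linear relation among the τ_i. So these vectors span, and each unit vector is a combination of them.
-/
theorem exists_sum_mul_eq_ite {E L I : Type*} [Field E] [Field L] [Finite I] [DecidableEq I]
    (τ : I → (E →+* L)) (hτ : Function.Injective τ) (k : I) :
    ∃ (s : Finset E) (c : E → L), ∀ i, ∑ b ∈ s, c b * τ i b = if i = k then 1 else 0 := by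
  have : Fintype I := Fintype.ofFinite I
  have hli : LinearIndependent L (fun i => ((τ i : E →* L) : E → L)) :=
    (linearIndependent_monoidHom E L).comp (fun i => (τ i : E →* L)) fun i i' h => hτ (by
      ext z; exact DFunLike.congr_fun h z)
  have hspan : Submodule.span L (Set.range fun (b : E) (i : I) => τ i b) = ⊤ := by
    by_contra hne
    obtain ⟨φ, hφ, hle⟩ := Submodule.exists_le_ker_of_lt_top _ (lt_top_iff_ne_top.2 hne)
    apply hφ
    have hzero := Fintype.linearIndependent_iff.1 hli (fun i => φ (Pi.single i 1)) (by
      funext b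
      have : φ (fun i => τ i b) = 0 := hle (Submodule.subset_span ⟨b, rfl⟩)
      rw [LinearMap.pi_apply_eq_sum_univ φ] at this
      have he (i : I) : (fun k => if i = k then (1 : L) else 0) = Pi.single i 1 := by
        ext k; simp [Pi.single_apply, eq_comm]
      simpa [he, mul_comm] using this)
    ext i
    simpa using hzero i
  have hk : (Pi.single k 1 : I → L) ∈ Submodule.span L (Set.range fun (b : E) (i : I) => τ i b) :=
    hspan ▸ Submodule.mem_top
  obtain ⟨c, hc⟩ := Finsupp.mem_span_range_iff_exists_finsupp.1 hk
  refine ⟨c.support, c, fun i => ?_⟩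
  have := congrFun hc i
  simpa [Finsupp.sum, Pi.single_apply] using this

/-- Skolem-Noether: an isomorphism of endomorphism algebras is conjugation by a linear equivalence,
which preserves determinants. -/
theorem Matrix.det_algEquiv {K B I : Type*} [Field K] [Ring B] [Algebra K B] [Fintype I]
    [DecidableEq I] {J : Type*} [Fintype J] [DecidableEq J]
    (φ : B ≃ₐ[K] Matrix I I K) (ψ : B ≃ₐ[K] Matrix J J K) (b : B) :
    (φ b).det = (ψ b).det := by
  obtain ⟨T, hT⟩ := (((Matrix.toLinAlgEquiv' (R := K) (n := I)).symm.trans φ.symm).trans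
    (ψ.trans (Matrix.toLinAlgEquiv' (R := K) (n := J)))).eq_linearEquivConjAlgEquiv
  have h := DFunLike.congr_fun hT (Matrix.toLinAlgEquiv' (φ b))
  simp only [AlgEquiv.trans_apply, AlgEquiv.symm_apply_apply] at h
  rw [← LinearMap.det_toLin', ← LinearMap.det_toLin' (ψ b)]
  change _ = LinearMap.det (Matrix.toLinAlgEquiv' (ψ b))
  rw [h]
  exact (LinearMap.det_conj _ T).symm

namespace CrossedOrder

variable {F E R I : Type*} [Field F] [Field E] [Algebra F E] [Ring R]
    [Algebra F[X] R] [Fintype I] (O : CrossedOrder F E R I)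

section Rank
variable (F E) [FiniteDimensional F E]

theorem free : Module.Free F[X] E[X] :=
  .of_equiv (Algebra.IsPushout.out (R := F) (S := F[X]) (R' := E) (S' := E[X])).equiv

theorem finite : Module.Finite F[X] E[X] :=
  .equiv (Algebra.IsPushout.out (R := F) (S := F[X]) (R' := E) (S' := E[X])).equiv

theorem finrank_polynomial : Module.finrank F[X] E[X] = Module.finrank F E := by
  rw [← (Algebra.IsPushout.out (R := F) (S := F[X]) (R' := E) (S' := E[X])).equiv.finrank_eq,
    Module.finrank_baseChange]

end Rank

section Splitting
variable [FiniteDimensional F E] {Ω : Type*} [Field Ω] [Algebra F[X] Ω]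
  [FaithfulSMul F[X] Ω] (θ : E[X] →ₐ[F[X]] Ω)

omit [FaithfulSMul F[X] Ω] in
theorem exists_algHom [IsAlgClosed Ω] : Nonempty (E[X] →ₐ[F[X]] Ω) := by
  let := ((algebraMap F[X] Ω).comp Polynomial.C).toAlgebra
  let φ : E →ₐ[F] Ω := IsAlgClosed.lift
  refine ⟨⟨Polynomial.eval₂RingHom (φ : E →+* Ω) (algebraMap F[X] Ω Polynomial.X), fun p => ?_⟩⟩
  change Polynomial.eval₂ _ _ (p.map (algebraMap F E)) = _
  rw [Polynomial.eval₂_map]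
  have : (φ : E →+* Ω).comp (algebraMap F E) = (algebraMap F[X] Ω).comp Polynomial.C :=
    φ.comp_algebraMap
  rw [this, ← Polynomial.hom_eval₂, Polynomial.eval₂_C_X]

include θ in
-- `E[X]` is a domain finite over `F[X]`, so a nonzero kernel would meet `F[X]` nontrivially.
theorem theta_injective : Function.Injective θ := by
  have := finite F E
  have hb : RingHom.ker θ = ⊥ := by
    have : IsDomain E[X] := inferInstance
    refine Ideal.eq_bot_of_comap_eq_bot (R := F[X]) ?_
    rw [eq_bot_iff]
    intro p hp
    have : θ (algebraMap F[X] E[X] p) = 0 := hp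
    rw [AlgHom.commutes] at this
    exact (FaithfulSMul.algebraMap_injective F[X] Ω) (this.trans (map_zero _).symm)
  exact (RingHom.injective_iff_ker_eq_bot _).2 hb

variable [DecidableEq I]

/-- The representation of `R` by matrices over an extension of `E[X]`. -/
noncomputable def rep : R →ₐ[F[X]] Matrix I I Ω := θ.mapMatrix.comp O.rho

omit [FiniteDimensional F E] [FaithfulSMul F[X] Ω] in
theorem rep_j (w : E[X]) : O.rep θ (O.j w)
    = Matrix.diagonal fun i => θ (w.map (O.g i : E →+* E)) := by
  ext l k
  have : O.rho (O.j w) l k = O.coord (O.j w * O.v k) l := rfl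
  rw [rep, AlgHom.comp_apply, AlgHom.mapMatrix_apply, Matrix.map_apply, this, O.j_mul_v,
    coord_mul_j, coord_v, Matrix.diagonal_apply, Pi.single_apply]
  by_cases h : l = k
  · simp [h]
  · simp [h]

/-- The span is closed under products. Constants of `E` act diagonally through distinct embeddings,
so Dedekind independence yields the diagonal idempotents. Sandwiching the image of `v l * b`, with
`b * v k = j y`, between two of them isolates the entry `θ y`, which is nonzero. -/
theorem single_mem (l k : I) : Matrix.single l k 1 ∈
    Submodule.span Ω (Set.range (O.rep θ)) := by
  have hmul : ∀ M N, M ∈ Submodule.span Ω (Set.range (O.rep θ)) →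
      N ∈ Submodule.span Ω (Set.range (O.rep θ)) →
      M * N ∈ Submodule.span Ω (Set.range (O.rep θ)) := by
    intro M N hM hN
    have h := Submodule.mul_mem_mul hM hN
    rw [Submodule.span_mul_span] at h
    refine Submodule.span_mono ?_ h
    rintro _ ⟨_, ⟨a, rfl⟩, _, ⟨b, rfl⟩, rfl⟩
    exact ⟨a * b, map_mul _ _ _⟩
  have hdiag : ∀ i : I, Matrix.single i i (1 : Ω) ∈ Submodule.span Ω (Set.range (O.rep θ)) := by
    intro i
    obtain ⟨s, c, hc⟩ := exists_sum_mul_eq_ite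
      (fun i : I => (θ : E[X] →+* Ω).comp (Polynomial.C.comp (O.g i : E →+* E))) (by
        intro i i' h
        apply O.g_injective
        ext z
        exact Polynomial.C_injective (theta_injective θ (RingHom.congr_fun h z))) i
    have : Matrix.single i i (1 : Ω) = ∑ b ∈ s, c b • O.rep θ (O.j (Polynomial.C b)) := by
      rw [← Matrix.diagonal_single]
      simp only [rep_j, ← Matrix.diagonal_smul]
      ext p q
      rw [Matrix.sum_apply]
      by_cases h : p = q
      · subst h
        simpa [Pi.single_apply] using (hc p).symm
      · simp [h]
    rw [this]
    exact Submodule.sum_mem _ fun b _ => Submodule.smul_mem _ _ (Submodule.subset_span ⟨_, rfl⟩)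
  obtain ⟨b, y, hy, hby⟩ := O.exists_mul_v k
  have hent : O.rep θ (O.v l * b) l k = θ y := by
    have : O.rho (O.v l * b) l k = O.coord (O.v l * b * O.v k) l := rfl
    rw [rep, AlgHom.comp_apply, AlgHom.mapMatrix_apply, Matrix.map_apply, this, mul_assoc, hby,
      coord_mul_j, coord_v]
    simp
  have hy' : θ y ≠ 0 := fun h => hy (theta_injective θ (h.trans (map_zero θ).symm))
  have h1 := hmul _ _ (hmul _ _ (hdiag l) (Submodule.subset_span ⟨O.v l * b, rfl⟩)) (hdiag k)
  rw [Matrix.single_mul_mul_single, hent, one_mul, mul_one] at h1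
  have h2 := Submodule.smul_mem _ (θ y)⁻¹ h1
  rwa [Matrix.smul_single, smul_eq_mul, inv_mul_cancel₀ hy'] at h2

theorem span_rep : Submodule.span Ω (Set.range (O.rep θ)) = ⊤ := by
  rw [eq_top_iff]
  intro M _
  rw [Matrix.matrix_eq_sum_single M]
  refine Submodule.sum_mem _ fun l _ => Submodule.sum_mem _ fun k _ => ?_
  have := Submodule.smul_mem _ (M l k) (O.single_mem θ l k)
  rwa [Matrix.smul_single, smul_eq_mul, mul_one] at this

end Splitting

section ReducedNorm
variable [FiniteDimensional F E] [DecidableEq I]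

/-- Surjectivity is `span_rep`. Injectivity is a dimension count: `R` has rank |I| · [E : F] = |I|²
over `F[X]`. -/
theorem exists_splitting (θ : E[X] →ₐ[F[X]] AlgebraicClosure (FractionRing F[X])) :
    ∃ φ : (AlgebraicClosure (FractionRing F[X]) ⊗[FractionRing F[X]] (FractionRing F[X] ⊗[F[X]] R))
        ≃ₐ[AlgebraicClosure (FractionRing F[X])]
        Matrix I I (AlgebraicClosure (FractionRing F[X])),
      ∀ b : R, φ (1 ⊗ₜ (1 ⊗ₜ b)) = O.rep θ b := by
  let ψ : (FractionRing F[X] ⊗[F[X]] R) →ₐ[FractionRing F[X]]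
      Matrix I I (AlgebraicClosure (FractionRing F[X])) :=
    Algebra.TensorProduct.lift (Algebra.ofId _ _) (O.rep θ) fun x y => Algebra.commutes _ _
  let φ := Algebra.TensorProduct.lift
    (Algebra.ofId (AlgebraicClosure (FractionRing F[X])) _) ψ fun x y => Algebra.commutes _ _
  have hφ : ∀ b : R, φ (1 ⊗ₜ (1 ⊗ₜ b)) = O.rep θ b := fun b => by
    refine (Algebra.TensorProduct.lift_tmul _ _ _ _ _).trans ?_
    rw [map_one, one_mul]
    refine (Algebra.TensorProduct.lift_tmul _ _ _ _ _).trans ?_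
    rw [map_one, one_mul]
  have : FaithfulSMul F[X] (AlgebraicClosure (FractionRing F[X])) := by
    rw [faithfulSMul_iff_algebraMap_injective,
      IsScalarTower.algebraMap_eq F[X] (FractionRing F[X])]
    exact (algebraMap (FractionRing F[X]) _).injective.comp
      (IsFractionRing.injective F[X] (FractionRing F[X]))
  have hsurj : Function.Surjective φ := by
    rw [← AlgHom.coe_toLinearMap, ← LinearMap.range_eq_top, eq_top_iff, ← O.span_rep θ,
      Submodule.span_le]
    rintro _ ⟨b, rfl⟩
    exact ⟨1 ⊗ₜ (1 ⊗ₜ b), hφ b⟩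
  have := free F E
  have := finite F E
  have : Module.Free F[X] R := .of_equiv O.coord.symm
  have : Module.Finite F[X] R := .equiv O.coord.symm
  have hrank : Module.finrank (AlgebraicClosure (FractionRing F[X]))
      (AlgebraicClosure (FractionRing F[X]) ⊗[FractionRing F[X]] (FractionRing F[X] ⊗[F[X]] R))
      = Module.finrank (AlgebraicClosure (FractionRing F[X]))
        (Matrix I I (AlgebraicClosure (FractionRing F[X]))) := by
    rw [Module.finrank_baseChange, Module.finrank_baseChange, O.coord.finrank_eq,
      Module.finrank_pi_fintype, Module.finrank_matrix]
    simp [finrank_polynomial, O.card_eq]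
  have hinj : Function.Injective φ :=
    (LinearMap.injective_iff_surjective_of_finrank_eq_finrank (f := φ.toLinearMap) hrank).2 hsurj
  exact ⟨AlgEquiv.ofBijective φ ⟨hinj, hsurj⟩, hφ⟩

theorem reducedNorm_eq (b : R) :
    reducedNorm (FractionRing F[X]) ((1 : FractionRing F[X]) ⊗ₜ[F[X]] b)
      = algebraMap F[X] (FractionRing F[X]) (O.nrm b) := by
  obtain ⟨θ⟩ := exists_algHom (F := F) (E := E) (Ω := AlgebraicClosure (FractionRing F[X]))
  obtain ⟨φ, hφ⟩ := O.exists_splitting θ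
  have hdet : (φ (1 ⊗ₜ (1 ⊗ₜ b))).det = algebraMap (FractionRing F[X])
      (AlgebraicClosure (FractionRing F[X])) (algebraMap F[X] _ (O.nrm b)) := by
    rw [hφ, ← IsScalarTower.algebraMap_apply, ← θ.commutes, algebraMap_nrm]
    exact (AlgHom.map_det θ (O.rho b)).symm
  have h : ∃ c, IsReducedNorm (FractionRing F[X]) ((1 : FractionRing F[X]) ⊗ₜ[F[X]] b) c :=
    ⟨_, Fintype.card I, φ.trans (Matrix.reindexAlgEquiv _ _ (Fintype.equivFin I)), by
      rw [← hdet, AlgEquiv.trans_apply, Matrix.det_reindexAlgEquiv]⟩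
  rw [reducedNorm, dif_pos h]
  obtain ⟨r, ψ, hψ⟩ := h.choose_spec
  apply (algebraMap (FractionRing F[X]) (AlgebraicClosure (FractionRing F[X]))).injective
  rw [← hψ, ← hdet]
  exact Matrix.det_algEquiv ψ φ _

end ReducedNorm
end CrossedOrder

/-! ### Coefficients of twisted polynomials -/

namespace TwistedData

variable {F C A : Type*} [Field F] [Field C] [Ring A] [Algebra F C] [Algebra C A]
  [FiniteDimensional F C] [IsGalois F C] (S : TwistedData F C A)

theorem coeff_zero (i : ℕ) : S.coeff 0 i = 0 := rfl

theorem coeff_add (f g : S.SkewRing) (i : ℕ) : S.coeff (f + g) i = S.coeff f i + S.coeff g i :=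
  let := S.action
  SkewPolynomial.coeff_add (R := A) f g i

/-- The `i`-th coefficient as an additive map. -/
def coeffHom (i : ℕ) : S.SkewRing →+ A where
  toFun f := S.coeff f i
  map_zero' := S.coeff_zero i
  map_add' f g := S.coeff_add f g i

theorem coeff_sub (f g : S.SkewRing) (i : ℕ) : S.coeff (f - g) i = S.coeff f i - S.coeff g i :=
  map_sub (S.coeffHom i) f g

theorem coeff_sum {ι : Type*} (s : Finset ι) (f : ι → S.SkewRing) (i : ℕ) :
    S.coeff (∑ k ∈ s, f k) i = ∑ k ∈ s, S.coeff (f k) i :=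
  map_sum (S.coeffHom i) f s

theorem ext_coeff {f g : S.SkewRing} (h : ∀ i, S.coeff f i = S.coeff g i) : f = g :=
  SkewPolynomial.ext (R := A) h

theorem coeff_const_mul_t_pow (a : A) (i k : ℕ) :
    S.coeff (S.const a * S.t ^ i) k = if i = k then a else 0 := by
  let := S.action
  have h : S.const a * S.t ^ i = (SkewPolynomial.monomial (R := A) i a : SkewPolynomial A) :=
    SkewPolynomial.C_mul_X_pow_eq_monomial (R := A) (n := i)
  rw [h]
  exact SkewPolynomial.coeff_monomial (R := A)

theorem induction_monomial {P : S.SkewRing → Prop} (h0 : P 0)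
    (hadd : ∀ f g, P f → P g → P (f + g)) (hmon : ∀ a i, P (S.const a * S.t ^ i))
    (f : S.SkewRing) : P f := by
  obtain ⟨s, hs⟩ := S.eq_sum f
  rw [hs]
  exact Finset.sum_induction _ P hadd h0 fun i _ => hmon _ _

theorem exists_coeff_eq_zero (f : S.SkewRing) : ∃ N, ∀ i, N ≤ i → S.coeff f i = 0 := by
  induction f using S.induction_monomial with
  | h0 => exact ⟨0, fun i _ => S.coeff_zero i⟩
  | hadd f g hf hg =>
    obtain ⟨M, hM⟩ := hf
    obtain ⟨N, hN⟩ := hg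
    exact ⟨max M N, fun i hi => by
      rw [coeff_add, hM i (le_trans (le_max_left _ _) hi), hN i (le_trans (le_max_right _ _) hi),
        add_zero]⟩
  | hmon a k =>
    refine ⟨k + 1, fun i hi => ?_⟩
    rw [coeff_const_mul_t_pow, if_neg (by omega)]

theorem coeff_const_mul (a : A) (f : S.SkewRing) (i : ℕ) :
    S.coeff (S.const a * f) i = a * S.coeff f i := by
  induction f using S.induction_monomial with
  | h0 => simp [coeff_zero]
  | hadd f g hf hg => rw [mul_add, coeff_add, coeff_add, hf, hg, mul_add]
  | hmon b k =>
    rw [← mul_assoc, ← map_mul, coeff_const_mul_t_pow, coeff_const_mul_t_pow]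
    split_ifs <;> simp

theorem coeff_mul_const (f : S.SkewRing) (a : A) (i : ℕ) :
    S.coeff (f * S.const a) i = S.coeff f i * (S.σ ^ i) a := by
  induction f using S.induction_monomial with
  | h0 => simp [coeff_zero]
  | hadd f g hf hg => rw [add_mul, coeff_add, coeff_add, hf, hg, add_mul]
  | hmon b k =>
    rw [mul_assoc, t_pow_mul_const, ← mul_assoc, ← map_mul, coeff_const_mul_t_pow,
      coeff_const_mul_t_pow]
    split_ifs with h
    · rw [h]
    · simp

theorem coeff_t_pow_mul (s : ℕ) (f : S.SkewRing) (i : ℕ) :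
    S.coeff (S.t ^ s * f) (s + i) = (S.σ ^ s) (S.coeff f i) := by
  induction f using S.induction_monomial with
  | h0 => simp [coeff_zero]
  | hadd f g hf hg => rw [mul_add, coeff_add, coeff_add, hf, hg, map_add]
  | hmon b k =>
    rw [← mul_assoc, t_pow_mul_const, mul_assoc, ← pow_add, coeff_const_mul_t_pow,
      coeff_const_mul_t_pow]
    simp only [add_right_inj]
    split_ifs <;> simp

theorem coeff_mul_t_pow (f : S.SkewRing) (s i : ℕ) :
    S.coeff (f * S.t ^ s) (i + s) = S.coeff f i := by
  induction f using S.induction_monomial with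
  | h0 => simp [coeff_zero]
  | hadd f g hf hg => rw [add_mul, coeff_add, coeff_add, hf, hg]
  | hmon b k =>
    rw [mul_assoc, ← pow_add, coeff_const_mul_t_pow, coeff_const_mul_t_pow]
    simp only [add_left_inj]

theorem hasDegree_of_ne_zero {f : S.SkewRing} (hf : f ≠ 0) : ∃ m, S.HasDegree f m := by
  classical
  have h := S.exists_coeff_eq_zero f
  obtain ⟨m, hm⟩ : ∃ m, Nat.find h = m + 1 := by
    refine Nat.exists_eq_succ_of_ne_zero fun h0 => hf (S.ext_coeff fun i => ?_)
    exact Nat.find_spec h i (by omega)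
  refine ⟨m, fun h0 => ?_, fun i hi => Nat.find_spec h i (by omega)⟩
  refine Nat.find_min h (m := m) (by omega) fun i hi => ?_
  rcases hi.eq_or_lt with rfl | hi
  · exact h0
  · exact Nat.find_spec h i (by omega)

/-! ### Left ideals of `A[t; σ]` are principal -/

/-- `e` is an idempotent generating a simple left ideal and every nonzero left ideal
has a nonzero element in `e A`. -/
structure _root_.IsPrimitiveIdempotent (e : A) : Prop where
  mul_self : e * e = e
  exists_eq_mul : ∀ a b, a * e = a → a ≠ 0 → b * e = b → ∃ c, b = c * a
  exists_mul_ne_zero : ∀ a, a ≠ 0 → ∃ c, e * c * a ≠ 0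

omit [Algebra C A] in
theorem _root_.IsPrimitiveIdempotent.map {e : A} (he : IsPrimitiveIdempotent e) (τ : A ≃+* A) :
    IsPrimitiveIdempotent (τ e) where
  mul_self := by rw [← map_mul, he.mul_self]
  exists_eq_mul a b ha h0 hb := by
    obtain ⟨c, hc⟩ := he.exists_eq_mul (τ.symm a) (τ.symm b)
      (by conv_rhs => rw [← ha]
          simp) (by simpa using h0)
      (by conv_rhs => rw [← hb]
          simp)
    exact ⟨τ c, by rw [← τ.apply_symm_apply b, hc]; simp⟩
  exists_mul_ne_zero a ha := by
    obtain ⟨c, hc⟩ := he.exists_mul_ne_zero (τ.symm a) (by simpa using ha)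
    refine ⟨τ c, fun h => hc ?_⟩
    apply τ.injective
    simpa using h

/-- Division with remainder works here although `A` has zero divisors: the i-th coefficient of an
element of `J` lies in the simple left ideal generated by σ^i(e), where any nonzero element
generates. -/
theorem exists_generator_of_primitive {e : A} (he : IsPrimitiveIdempotent e)
    (J : Ideal S.SkewRing) (hJ : ∀ h ∈ J, h * S.const e = h) :
    ∃ g ∈ J, S.const e * g = g ∧ ∀ h ∈ J, ∃ r, h = r * g := by
  classical
  by_cases hne : ∃ m, ∃ g ∈ J, S.HasDegree g m
  swap
  · refine ⟨0, J.zero_mem, mul_zero _, fun h hh => ⟨0, ?_⟩⟩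
    by_contra h0
    obtain ⟨m, hm⟩ := S.hasDegree_of_ne_zero (f := h) (by simpa using h0)
    exact hne ⟨m, h, hh, hm⟩
  obtain ⟨g₀, hg₀, hdeg₀⟩ := Nat.find_spec hne
  have hmin := fun k (hk : k < Nat.find hne) => Nat.find_min hne hk
  set m := Nat.find hne
  obtain ⟨c, hc⟩ := he.exists_mul_ne_zero _ hdeg₀.1
  -- Multiplying by `e * c` makes the generator fixed by `e` on the left while `c` keeps its leading
  -- coefficient nonzero.
  set g := S.const (e * c) * g₀ with hg
  have hgJ : g ∈ J := J.mul_mem_left _ hg₀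
  have hgm : S.coeff g m ≠ 0 := by rwa [hg, coeff_const_mul]
  refine ⟨g, hgJ, by rw [hg, ← mul_assoc, ← map_mul, ← mul_assoc, he.mul_self], ?_⟩
  have hred : ∀ N, ∀ h ∈ J, (∀ i, N ≤ i → S.coeff h i = 0) → ∃ r, h = r * g := by
    intro N
    induction N with
    | zero =>
      intro h _ h0
      exact ⟨0, by rw [zero_mul]; exact S.ext_coeff fun i => h0 i (Nat.zero_le i)⟩
    | succ N ih =>
      intro h hh h0
      by_cases hN : S.coeff h N = 0
      · refine ih h hh fun i hi => ?_
        rcases hi.eq_or_lt with rfl | hi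
        · exact hN
        · exact h0 i hi
      have hmN : m ≤ N := by
        by_contra hlt
        exact hmin N (by omega) ⟨h, hh, hN, h0⟩
      obtain ⟨k, rfl⟩ := Nat.exists_eq_add_of_le' hmN
      obtain ⟨c, hc⟩ := (he.map (S.σ ^ (k + m))).exists_eq_mul ((S.σ ^ k) (S.coeff g m))
        (S.coeff h (k + m))
        (by
          conv_rhs => rw [← hJ g hgJ, coeff_mul_const]
          rw [map_mul, pow_add]; rfl)
        (fun h => hgm ((map_eq_zero_iff _ (S.σ ^ k).injective).1 h))
        (by rw [← coeff_mul_const, hJ h hh])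
      obtain ⟨r, hr⟩ := ih (h - S.const c * S.t ^ k * g) (J.sub_mem hh (J.mul_mem_left _ hgJ))
        (by
          intro i hi
          obtain ⟨i, rfl⟩ := Nat.exists_eq_add_of_le (le_trans (Nat.le_add_right k m) hi)
          rw [coeff_sub, mul_assoc, coeff_const_mul, coeff_t_pow_mul]
          rcases (show m ≤ i by omega).eq_or_lt with rfl | hi
          · rw [← hc, sub_self]
          · rw [h0 _ (by omega), hg, coeff_const_mul, hdeg₀.2 i hi]
            simp)
      exact ⟨r + S.const c * S.t ^ k, by rw [add_mul, ← hr, sub_add_cancel]⟩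
  intro h hh
  obtain ⟨N, hN⟩ := S.exists_coeff_eq_zero h
  exact hred N h hh hN

/-- Induction along the exact sequence that right multiplication by the new idempotent induces on
`I`: image and kernel each have a generator. Left fixedness under orthogonal idempotents lets a
single sum of (lifted) generators recover both summands. -/
theorem exists_generator_of_orthogonal {ι : Type*} (e : ι → A)
    (he : ∀ i, IsPrimitiveIdempotent (e i)) (horth : ∀ i k, i ≠ k → e i * e k = 0)
    (s : Finset ι) :
    ∀ I : Ideal S.SkewRing, (∀ h ∈ I, h * S.const (∑ i ∈ s, e i) = h) →
      ∃ g ∈ I, S.const (∑ i ∈ s, e i) * g = g ∧ ∀ h ∈ I, ∃ r, h = r * g := by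
  classical
  induction s using Finset.induction with
  | empty =>
    intro I hI
    refine ⟨0, I.zero_mem, mul_zero _, fun h hh => ⟨0, ?_⟩⟩
    rw [← hI h hh]; simp
  | insert l s hl ih =>
    intro I hI
    rw [Finset.sum_insert hl] at hI ⊢
    set ε := ∑ i ∈ s, e i with hε
    have hlε : e l * ε = 0 := by
      rw [hε, Finset.mul_sum]
      exact Finset.sum_eq_zero fun i hi => horth _ _ (by rintro rfl; exact hl hi)
    have hεl : ε * e l = 0 := by
      rw [hε, Finset.sum_mul]
      exact Finset.sum_eq_zero fun i hi => horth _ _ (by rintro rfl; exact hl hi)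
    have hεε : ε * ε = ε := by
      conv_lhs => rw [hε, Finset.sum_mul]
      refine Finset.sum_congr rfl fun i hi => ?_
      rw [Finset.mul_sum, Finset.sum_eq_single i (fun k _ hk => horth _ _ hk.symm)
        (fun h => absurd hi h), (he i).mul_self]
    obtain ⟨g', hg', hlg', hgen'⟩ := S.exists_generator_of_primitive (he l)
      (Submodule.map (LinearMap.toSpanSingleton S.SkewRing S.SkewRing (S.const (e l))) I) (by
        rintro _ ⟨h, hh, rfl⟩
        simp only [LinearMap.toSpanSingleton_apply, smul_eq_mul]
        rw [mul_assoc, ← map_mul, (he l).mul_self])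
    obtain ⟨q, hq, hqg⟩ := hg'
    simp only [LinearMap.toSpanSingleton_apply, smul_eq_mul] at hqg
    obtain ⟨g₀, hg₀, hεg₀, hgen₀⟩ := ih
      (I ⊓ LinearMap.ker (LinearMap.toSpanSingleton S.SkewRing S.SkewRing (S.const ε - 1))) (by
        rintro h ⟨-, hh⟩
        rw [SetLike.mem_coe, LinearMap.mem_ker, LinearMap.toSpanSingleton_apply, smul_eq_mul,
          mul_sub, mul_one, sub_eq_zero] at hh
        exact hh)
    set g₁ := S.const (e l) * q with hg₁
    have hg₁l : g₁ * S.const (e l) = g' := by rw [hg₁, mul_assoc, hqg, hlg']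
    have hlg₁ : S.const (e l) * g₁ = g₁ := by
      rw [hg₁, ← mul_assoc, ← map_mul, (he l).mul_self]
    have hεg₁ : S.const ε * g₁ = 0 := by
      rw [hg₁, ← mul_assoc, ← map_mul, hεl, map_zero, zero_mul]
    have hlg₀ : S.const (e l) * g₀ = 0 := by
      rw [← hεg₀, ← mul_assoc, ← map_mul, hlε, map_zero, zero_mul]
    refine ⟨g₀ + g₁, I.add_mem hg₀.1 (I.mul_mem_left _ hq), ?_, fun h hh => ?_⟩
    · rw [map_add, add_mul, mul_add, mul_add, hlg₀, hlg₁, hεg₀, hεg₁]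
      abel
    · obtain ⟨r, hr⟩ := hgen' (h * S.const (e l)) ⟨h, hh, rfl⟩
      have hmem : h - r * g₁ ∈ I := I.sub_mem hh (I.mul_mem_left _ (I.mul_mem_left _ hq))
      have hz : (h - r * g₁) * S.const (e l) = 0 := by
        rw [sub_mul, hr, mul_assoc, hg₁l, sub_self]
      obtain ⟨r', hr'⟩ := hgen₀ (h - r * g₁) ⟨hmem, by
        have := hI _ hmem
        rw [map_add, mul_add, hz, zero_add] at this
        rw [SetLike.mem_coe, LinearMap.mem_ker, LinearMap.toSpanSingleton_apply, smul_eq_mul,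
          mul_sub, mul_one, this, sub_self]⟩
      refine ⟨r' * S.const ε + r * S.const (e l), ?_⟩
      rw [mul_add, add_mul, add_mul, mul_assoc, mul_assoc, mul_assoc, mul_assoc, hεg₀, hlg₀,
        hεg₁, hlg₁, ← hr']
      simp

theorem isPrimitiveIdempotent_single {D ι : Type*} [DivisionRing D] [Fintype ι] [DecidableEq ι]
    (φ : A ≃+* Matrix ι ι D) (l : ι) :
    IsPrimitiveIdempotent (φ.symm (Matrix.single l l 1)) where
  mul_self := by rw [← map_mul]; simp
  exists_eq_mul a b ha h0 hb := by
    have hcol : ∀ a, a * φ.symm (Matrix.single l l 1) = a → ∀ p q, q ≠ l → φ a p q = 0 := by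
      intro a ha p q hq
      rw [← ha, map_mul, φ.apply_symm_apply, Matrix.mul_apply]
      exact Finset.sum_eq_zero fun i _ => by simp [hq.symm]
    obtain ⟨p, hp⟩ : ∃ p, φ a p l ≠ 0 := by
      by_contra! h
      apply h0
      apply φ.injective
      ext p q
      rw [map_zero, Matrix.zero_apply]
      by_cases hq : q = l
      · rw [hq, h]
      · exact hcol a ha p q hq
    refine ⟨φ.symm (Matrix.of fun i k => if k = p then φ b i l * (φ a p l)⁻¹ else 0), ?_⟩
    apply φ.injective
    ext i q
    rw [map_mul, φ.apply_symm_apply, Matrix.mul_apply]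
    by_cases hq : q = l
    · subst hq
      simp [hp]
    · rw [hcol b hb i q hq]
      exact (Finset.sum_eq_zero fun k _ => by rw [hcol a ha k q hq, mul_zero]).symm
  exists_mul_ne_zero a ha := by
    obtain ⟨p, q, hpq⟩ : ∃ p q, φ a p q ≠ 0 := by
      by_contra! h
      exact ha (φ.injective (by ext p q; simp [h]))
    refine ⟨φ.symm (Matrix.single l p 1), fun h => hpq ?_⟩
    have := congrFun (congrFun (congrArg φ h) l) q
    simpa [Matrix.single_mul_apply_same] using this

/-- By Wedderburn-Artin, `A` is a matrix ring over a division ring, and its diagonal matrix units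
are orthogonal primitive idempotents with sum 1. -/
theorem exists_generator [IsSimpleRing A] [IsArtinianRing A] (I : Ideal S.SkewRing) :
    ∃ g ∈ I, ∀ h ∈ I, ∃ r, h = r * g := by
  obtain ⟨k, _, D, _, ⟨φ⟩⟩ := IsSimpleRing.exists_ringEquiv_matrix_divisionRing A
  have hsum : ∑ l : Fin k, φ.symm (Matrix.single l l 1) = 1 := by
    rw [← map_sum, Matrix.sum_single_one, map_one]
  obtain ⟨g, hg, -, hgen⟩ := S.exists_generator_of_orthogonal
    (fun l => φ.symm (Matrix.single l l 1)) (isPrimitiveIdempotent_single φ)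
    (fun i k hik => by rw [← map_mul]; simp [hik]) Finset.univ I (by simp [hsum])
  exact ⟨g, hg, hgen⟩

end TwistedData

/-! ### Cyclic algebras are simple and Artinian -/

namespace CyclicAlgebra

variable {C E A : Type*} [Field C] [Field E] [Ring A] [Algebra C E] [Algebra C A]
    [FiniteDimensional C E] [IsGalois C E] (T : CyclicAlgebra C E A)

include T in
theorem nontrivial : Nontrivial A := by
  by_contra h
  rw [not_nontrivial_iff_subsingleton] at h
  obtain ⟨z, -, hz⟩ := T.existsUnique_repr 0
  have h0 := (hz 0 (Subsingleton.elim _ _)).trans (hz 1 (Subsingleton.elim _ _)).symm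
  exact zero_ne_one (congrFun h0 ⟨0, Module.finrank_pos⟩)

theorem ι_injective : Function.Injective T.ι :=
  have := T.nontrivial
  T.ι.toRingHom.injective

theorem isUnit_e : IsUnit T.e := by
  rw [← isUnit_pow_iff (Module.finrank_pos (R := C) (M := E)).ne', T.e_pow]
  exact (IsUnit.mk0 _ T.a_ne_zero).map (algebraMap C A)

theorem orderOf_γ : orderOf T.γ = Module.finrank C E := by
  rw [orderOf_eq_card_of_forall_mem_zpowers T.γ_generates, IsGalois.card_aut_eq_finrank]

theorem γ_pow_injective :
    Function.Injective fun i : Fin (Module.finrank C E) => T.γ ^ (i : ℕ) := by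
  intro i k h
  have := T.orderOf_γ
  exact Fin.ext (pow_injOn_Iio_orderOf (by simp [this]) (by simp [this]) h)

theorem e_pow_mul (i : ℕ) (z : E) : T.e ^ i * T.ι z = T.ι ((T.γ ^ i) z) * T.e ^ i := by
  induction i generalizing z with
  | zero => simp
  | succ i ih => rw [pow_succ, mul_assoc, T.e_mul, ← mul_assoc, ih, mul_assoc]; rfl

theorem existsUnique_right_repr (y : A) :
    ∃! z : Fin (Module.finrank C E) → E, ∑ i : Fin (Module.finrank C E), T.e ^ (i : ℕ) * T.ι (z i) = y := by
  obtain ⟨z, hz, huniq⟩ := T.existsUnique_repr y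
  refine ⟨fun i => (T.γ ^ (i : ℕ)).symm (z i), ?_, fun w hw => ?_⟩
  · simp only [e_pow_mul, AlgEquiv.apply_symm_apply]
    exact hz.symm
  · have := huniq (fun i => (T.γ ^ (i : ℕ)) (w i)) (by simp only [← e_pow_mul]; exact hw.symm)
    funext i
    rw [← this, AlgEquiv.symm_apply_apply]

include T in
-- Two-sided multiplication by elements of `E`, weighted as in `exists_sum_mul_eq_ite`, extracts a
-- single nonzero term z_k e^k from an element of an ideal. Such a term is a unit.
theorem isSimpleRing : IsSimpleRing A := by
  classical
  have := T.nontrivial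
  refine ⟨⟨fun I => ?_⟩⟩
  rw [or_iff_not_imp_left]
  intro hI
  obtain ⟨y, hy, hy0⟩ : ∃ y ∈ I, y ≠ 0 := by
    by_contra! h
    refine hI (eq_bot_iff.2 fun y hy => ?_)
    rw [TwoSidedIdeal.mem_bot]
    exact h y hy
  obtain ⟨z, hz, -⟩ := T.existsUnique_repr y
  obtain ⟨k, hk⟩ : ∃ k, z k ≠ 0 := by
    by_contra! h
    exact hy0 (by rw [hz]; simp [h])
  obtain ⟨s, c, hc⟩ := exists_sum_mul_eq_ite
    (fun i : Fin (Module.finrank C E) => ((T.γ ^ (i : ℕ) : E ≃ₐ[C] E) : E →+* E))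
    (fun i i' h => T.γ_pow_injective (by ext z; exact RingHom.congr_fun h z)) k
  have hmem : ∑ b ∈ s, T.ι (c b) * y * T.ι b ∈ I :=
    sum_mem fun b _ => I.mul_mem_right _ _ (I.mul_mem_left _ _ hy)
  have hsum : ∑ b ∈ s, T.ι (c b) * y * T.ι b = T.ι (z k) * T.e ^ (k : ℕ) := by
    calc ∑ b ∈ s, T.ι (c b) * y * T.ι b
        = ∑ i, T.ι (z i * ∑ b ∈ s, c b * (T.γ ^ (i : ℕ)) b) * T.e ^ (i : ℕ) := by
          simp only [Finset.mul_sum, map_sum, Finset.sum_mul]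
          rw [Finset.sum_comm]
          refine Finset.sum_congr rfl fun b _ => ?_
          rw [hz, Finset.mul_sum, Finset.sum_mul]
          refine Finset.sum_congr rfl fun i _ => ?_
          rw [mul_assoc, mul_assoc (T.ι (z i)), T.e_pow_mul, ← mul_assoc, ← mul_assoc, ← map_mul,
            ← map_mul]
          congr 2
          ring
      _ = _ := by
          rw [Finset.sum_eq_single k]
          · have := hc k
            rw [if_pos rfl] at this
            exact congrArg (fun w => T.ι w * T.e ^ (k : ℕ)) ((congrArg _ this).trans (mul_one _))
          · intro i _ hi
            have := hc i
            rw [if_neg hi] at this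
            exact (congrArg (fun w => T.ι (z i * w) * T.e ^ (i : ℕ)) this).trans (by simp)
          · simp
  rw [hsum] at hmem
  obtain ⟨w, hw⟩ := ((IsUnit.mk0 _ hk).map T.ι).mul (T.isUnit_e.pow (k : ℕ))
  refine eq_top_iff.2 fun b _ => ?_
  have := I.mul_mem_left (b * ↑w⁻¹) _ hmem
  rwa [← hw, mul_assoc, Units.inv_mul, mul_one] at this

include T in
theorem finite : Module.Finite C A := by
  refine Module.Finite.of_surjective
    (∑ i : Fin (Module.finrank C E), (LinearMap.mulRight C (T.e ^ (i : ℕ))) ∘ₗ T.ι.toLinearMap ∘ₗ LinearMap.proj i :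
      (Fin (Module.finrank C E) → E) →ₗ[C] A) fun y => ?_
  obtain ⟨z, hz, -⟩ := T.existsUnique_repr y
  exact ⟨z, by rw [hz]; simp⟩

include T in
theorem isArtinianRing : IsArtinianRing A :=
  have := T.finite
  .of_finite C A

end CyclicAlgebra

/-! ### The basis e^k t^i of `A[t; σ]` over `E[x]` -/

namespace TwistedData

variable {F C A : Type*} [Field F] [Field C] [Ring A] [Algebra F C] [Algebra C A]
  [FiniteDimensional F C] [IsGalois F C] (S : TwistedData F C A)

theorem t_pow_finrank : S.t ^ Module.finrank F C = S.const (S.u : A) * S.x := by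
  rw [x, ← mul_assoc, ← map_mul, Units.mul_inv, map_one, one_mul]

theorem x_pow (q : ℕ) :
    S.x ^ q = S.const ((S.u⁻¹ : Aˣ) : A) ^ q * S.t ^ (Module.finrank F C * q) := by
  have h : Commute S.x (S.const (S.u : A)) := S.x_commute _
  have h' : Commute (S.const ((S.u⁻¹ : Aˣ) : A)) (S.t ^ Module.finrank F C) := by
    rw [t_pow_finrank]
    refine Commute.mul_right ?_ (S.x_commute _).symm
    rw [Commute, SemiconjBy, ← map_mul, ← map_mul, Units.inv_mul, Units.mul_inv]
  rw [x, h'.mul_pow, pow_mul]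

theorem σC_pow_injective :
    Function.Injective fun i : Fin (Module.finrank F C) => S.σC ^ (i : ℕ) := by
  intro i k h
  have : orderOf S.σC = Module.finrank F C := by
    rw [orderOf_eq_card_of_forall_mem_zpowers S.σC_generates, IsGalois.card_aut_eq_finrank]
  exact Fin.ext (pow_injOn_Iio_orderOf (by simp [this]) (by simp [this]) h)

section Crossed

variable {E : Type*} [Field E] [Algebra C E] [FiniteDimensional C E] [IsGalois C E]
  (T : CyclicAlgebra C E A) (σE : E ≃+* E) (hσE : ∀ z : E, S.σ (T.ι z) = T.ι (σE z))

/-- The embedding of `E[X]` into `A[t; σ]` that sends `X` to `x`. -/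
noncomputable def polyHom : E[X] →+* S.SkewRing :=
  Polynomial.eval₂RingHom' (S.const.comp T.ι.toRingHom) S.x fun _ => (S.x_commute _).symm

theorem polyHom_monomial (q : ℕ) (w : E) :
    S.polyHom T (Polynomial.monomial q w) = S.const (T.ι w) * S.x ^ q :=
  Polynomial.eval₂_monomial _ _

variable {u : E} (hu : T.ι u = (S.u : A))

include hu in
theorem ι_inv_u : T.ι u⁻¹ = ((S.u⁻¹ : Aˣ) : A) := by
  have := T.nontrivial
  have hu0 : u ≠ 0 := by
    rintro rfl
    rw [map_zero] at hu
    exact S.u.ne_zero hu.symm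
  rw [← mul_one (T.ι u⁻¹), ← S.u.mul_inv, ← mul_assoc, ← hu, ← map_mul, inv_mul_cancel₀ hu0,
    map_one, one_mul]

include hσE

theorem σ_pow_ι (i : ℕ) (z : E) : (S.σ ^ i) (T.ι z) = T.ι ((σE ^ i) z) := by
  induction i generalizing z with
  | zero => rfl
  | succ i ih =>
    rw [pow_succ, pow_succ]
    change (S.σ ^ i) (S.σ (T.ι z)) = T.ι ((σE ^ i) (σE z))
    rw [hσE, ih]

theorem σE_algebraMap (c : C) : σE (algebraMap C E c) = algebraMap C E (S.σC c) := by
  apply T.ι_injective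
  rw [← hσE, AlgHom.commutes, AlgHom.commutes, S.σ_algebraMap]

theorem σE_pow_algebraMap (i : ℕ) (c : C) :
    (σE ^ i) (algebraMap C E c) = algebraMap C E ((S.σC ^ i) c) := by
  induction i generalizing c with
  | zero => rfl
  | succ i ih =>
    rw [pow_succ, pow_succ]
    change (σE ^ i) (σE _) = algebraMap C E ((S.σC ^ i) (S.σC c))
    rw [S.σE_algebraMap T σE hσE, ih]

include hu

/-- Since x^q = u^{-q} t^{nq}, the exponent of t determines i as its residue modulo n and q as the
quotient. -/
theorem coeff_basis_mul (k i q : ℕ) (w : E[X]) (hi : i < Module.finrank F C) (i' : ℕ)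
    (hi' : i' < Module.finrank F C) :
    S.coeff (S.const (T.e ^ k) * S.t ^ i * S.polyHom T w) (i' + Module.finrank F C * q)
      = if i = i' then T.e ^ k * T.ι ((σE ^ i) (w.coeff q * u⁻¹ ^ q)) else 0 := by
  induction w using Polynomial.induction_on' with
  | add p r hp hr =>
    rw [map_add, mul_add, coeff_add, hp, hr]
    split_ifs
    · rw [Polynomial.coeff_add, add_mul, map_add, map_add, mul_add]
    · rw [add_zero]
  | monomial p b =>
    have h : S.const (T.e ^ k) * S.t ^ i * S.polyHom T (Polynomial.monomial p b)
        = S.const (T.e ^ k * T.ι ((σE ^ i) (b * u⁻¹ ^ p))) *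
          S.t ^ (i + Module.finrank F C * p) := by
      rw [polyHom_monomial, x_pow, ← S.ι_inv_u T hu, ← mul_assoc (S.const (T.ι b)),
        ← map_pow, ← map_mul, ← map_pow, ← map_mul, ← mul_assoc,
        mul_assoc _ (S.t ^ i), t_pow_mul_const, S.σ_pow_ι T σE hσE, ← mul_assoc, ← map_mul,
        mul_assoc, ← pow_add]
    rw [h, coeff_const_mul_t_pow, Polynomial.coeff_monomial]
    by_cases hii : i = i'
    · subst hii
      by_cases hpq : p = q
      · subst hpq; simp
      · have : ¬ (i + Module.finrank F C * p = i + Module.finrank F C * q) := by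
          intro h
          exact hpq (Nat.eq_of_mul_eq_mul_left (Nat.zero_lt_of_lt hi) (Nat.add_left_cancel h))
        simp [hpq]
        omega
    · rw [if_neg, if_neg hii]
      intro h
      apply hii
      have := congrArg (· % Module.finrank F C) h
      simpa [Nat.mod_eq_of_lt hi, Nat.mod_eq_of_lt hi'] using this

/-- The element `e ^ k t ^ i` of the basis of `A[t; σ]` over `E[x]`. -/
noncomputable def basisElem (l : Fin (Module.finrank C E) × Fin (Module.finrank F C)) : S.SkewRing :=
  S.const (T.e ^ (l.1 : ℕ)) * S.t ^ (l.2 : ℕ)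

theorem coeff_comb (c : Fin (Module.finrank C E) × Fin (Module.finrank F C) → E[X])
    (i : Fin (Module.finrank F C)) (q : ℕ) :
    S.coeff (∑ l, S.basisElem T l * S.polyHom T (c l)) (i + Module.finrank F C * q)
      = ∑ k : Fin (Module.finrank C E), T.e ^ (k : ℕ) * T.ι ((σE ^ (i : ℕ)) ((c (k, i)).coeff q * u⁻¹ ^ q)) := by
  rw [coeff_sum, Fintype.sum_prod_type]
  refine Finset.sum_congr rfl fun k _ => ?_
  rw [Finset.sum_eq_single i]
  · rw [basisElem, S.coeff_basis_mul T σE hσE hu _ _ _ _ i.2 _ i.2, if_pos rfl]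
  · intro i' _ hi'
    rw [basisElem, S.coeff_basis_mul T σE hσE hu _ _ _ _ i'.2 _ i.2,
      if_neg fun h => hi' (Fin.ext h)]
  · simp

end Crossed

end TwistedData

namespace TwistedData

variable {F C A : Type*} [Field F] [Field C] [Ring A] [Algebra F C] [Algebra C A]
  [FiniteDimensional F C] [IsGalois F C] (S : TwistedData F C A)
  {E : Type*} [Field E] [Algebra C E] [FiniteDimensional C E] [IsGalois C E]
  (T : CyclicAlgebra C E A) (σE : E ≃+* E) (hσE : ∀ z : E, S.σ (T.ι z) = T.ι (σE z))
  {u : E} (hu : T.ι u = (S.u : A))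

section Basis

include hu in
theorem u_ne_zero : u ≠ 0 := by
  have := T.nontrivial
  rintro rfl
  rw [map_zero] at hu
  exact S.u.ne_zero hu.symm

include hσE hu

theorem coeff_eq_zero_of_comb (c : Fin (Module.finrank C E) × Fin (Module.finrank F C) → E[X])
    (i : Fin (Module.finrank F C)) (q : ℕ)
    (h : S.coeff (∑ l, S.basisElem T l * S.polyHom T (c l)) (i + Module.finrank F C * q) = 0)
    (k : Fin (Module.finrank C E)) : (c (k, i)).coeff q = 0 := by
  rw [S.coeff_comb T σE hσE hu] at h
  have h0 := congrFun ((T.existsUnique_right_repr 0).unique h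
    (y₂ := fun _ => 0) (by simp)) k
  rw [map_eq_zero_iff _ (σE ^ (i : ℕ)).injective] at h0
  exact (mul_eq_zero.1 h0).resolve_right (pow_ne_zero _ (inv_ne_zero (S.u_ne_zero T hu)))

theorem comb_injective :
    Function.Injective fun c : Fin (Module.finrank C E) × Fin (Module.finrank F C) → E[X] =>
      ∑ l, S.basisElem T l * S.polyHom T (c l) := by
  intro c c' h
  have h0 : ∑ l, S.basisElem T l * S.polyHom T ((c - c') l) = 0 := by
    rw [← sub_eq_zero.2 h]
    simp [mul_sub]
  funext ⟨k, i⟩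
  ext q
  have := S.coeff_eq_zero_of_comb T σE hσE hu (c - c') i q (by rw [h0, coeff_zero]) k
  simpa [sub_eq_zero] using this

theorem comb_surjective :
    Function.Surjective fun c : Fin (Module.finrank C E) × Fin (Module.finrank F C) → E[X] =>
      ∑ l, S.basisElem T l * S.polyHom T (c l) := by
  intro f
  choose z hz _ using fun i => T.existsUnique_right_repr (S.coeff f i)
  obtain ⟨N, hN⟩ := S.exists_coeff_eq_zero f
  have hn : 0 < Module.finrank F C := Module.finrank_pos
  -- The factor `u ^ q` cancels the u^{-q} hidden in x^q, and the inverse of σ^i undoes moving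
  -- coefficients past t^i.
  refine ⟨fun l => ∑ q ∈ Finset.range N, Polynomial.monomial q
    ((σE ^ (l.2 : ℕ)).symm (z (l.2 + Module.finrank F C * q) l.1) * u ^ q), ?_⟩
  refine S.ext_coeff fun s => ?_
  obtain ⟨i, q, rfl⟩ : ∃ (i : Fin (Module.finrank F C)) (q : ℕ),
      s = i + Module.finrank F C * q :=
    ⟨⟨s % Module.finrank F C, Nat.mod_lt _ hn⟩, s / Module.finrank F C, (Nat.mod_add_div _ _).symm⟩
  rw [S.coeff_comb T σE hσE hu]
  by_cases hq : q < N
  · rw [← hz]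
    refine Finset.sum_congr rfl fun k _ => ?_
    rw [Polynomial.finsetSum_coeff, Finset.sum_eq_single q]
    · rw [Polynomial.coeff_monomial, if_pos rfl, mul_assoc, ← mul_pow,
        mul_inv_cancel₀ (S.u_ne_zero T hu), one_pow, mul_one, RingEquiv.apply_symm_apply]
    · intro p _ hp
      rw [Polynomial.coeff_monomial, if_neg hp]
    · intro h
      exact absurd (Finset.mem_range.2 hq) h
  · rw [hN]
    · refine Finset.sum_eq_zero fun k _ => ?_
      rw [Polynomial.finsetSum_coeff, Finset.sum_eq_zero]
      · simp
      · intro p hp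
        rw [Polynomial.coeff_monomial, if_neg]
        rintro rfl
        exact hq (Finset.mem_range.1 hp)
    · nlinarith

end Basis

/-! ### The crossed product order and the degree of the norm -/

section Order

variable [Algebra F E] [IsScalarTower F C E]

/-- The automorphism of `E/F` induced by the basis element `e ^ k t ^ i`. -/
noncomputable def autE (l : Fin (Module.finrank C E) × Fin (Module.finrank F C)) : E ≃ₐ[F] E :=
  -- The inverse appears because scalars are moved from the left of the basis element to its right.
  (AlgEquiv.ofRingEquiv (f := (σE ^ (l.2 : ℕ)).trans (T.γ ^ (l.1 : ℕ)).toRingEquiv) fun c => by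
    rw [IsScalarTower.algebraMap_apply F C E, RingEquiv.trans_apply,
      S.σE_pow_algebraMap T σE hσE, AlgEquiv.commutes]
    exact AlgEquiv.commutes _ _).symm

theorem autE_symm_apply (l : Fin (Module.finrank C E) × Fin (Module.finrank F C)) (z : E) :
    (S.autE T σE hσE l).symm z = (T.γ ^ (l.1 : ℕ)) ((σE ^ (l.2 : ℕ)) z) := rfl

theorem autE_injective : Function.Injective (S.autE T σE hσE) := by
  intro l l' h
  have h1 : ∀ z, (T.γ ^ (l.1 : ℕ)) ((σE ^ (l.2 : ℕ)) z)
      = (T.γ ^ (l'.1 : ℕ)) ((σE ^ (l'.2 : ℕ)) z) := fun z => by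
    rw [← S.autE_symm_apply T σE hσE, ← S.autE_symm_apply T σE hσE, h]
  have h2 : l.2 = l'.2 := by
    apply S.σC_pow_injective
    ext c
    have := h1 (algebraMap C E c)
    rw [S.σE_pow_algebraMap T σE hσE, S.σE_pow_algebraMap T σE hσE, AlgEquiv.commutes,
      AlgEquiv.commutes] at this
    exact (algebraMap C E).injective this
  refine Prod.ext (T.γ_pow_injective ?_) h2
  ext z
  have := h1 ((σE ^ (l.2 : ℕ)).symm z)
  rwa [← h2, RingEquiv.apply_symm_apply] at this

theorem polyHom_mul_basisElem (l : Fin (Module.finrank C E) × Fin (Module.finrank F C))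
    (w : E[X]) : S.polyHom T w * S.basisElem T l
      = S.basisElem T l * S.polyHom T (w.map (S.autE T σE hσE l : E →+* E)) := by
  induction w using Polynomial.induction_on' with
  | add p q hp hq => rw [map_add, add_mul, hp, hq, Polynomial.map_add, map_add, mul_add]
  | monomial q b =>
    rw [Polynomial.map_monomial, polyHom_monomial, polyHom_monomial, mul_assoc,
      ((S.x_commute _).pow_left q).eq, ← mul_assoc, ← mul_assoc]
    congr 1
    obtain ⟨z, rfl⟩ := (S.autE T σE hσE l).symm.surjective b
    rw [basisElem, mul_assoc (S.const _), t_pow_mul_const, ← mul_assoc, ← mul_assoc, ← map_mul,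
      ← map_mul]
    congr 2
    rw [RingHom.coe_coe, AlgEquiv.apply_symm_apply, S.σ_pow_ι T σE hσE, T.e_pow_mul,
      S.autE_symm_apply T σE hσE]

/-- `A[t; σ]` is an order in a crossed product of `E[x]` with the group generated by `γ`
and `σ`. -/
noncomputable def crossedOrder :
    CrossedOrder F E S.SkewRing (Fin (Module.finrank C E) × Fin (Module.finrank F C)) where
  j := S.polyHom T
  j_map p := by
    induction p using Polynomial.induction_on' with
    | add p q hp hq => rw [Polynomial.map_add, map_add, hp, hq, map_add]
    | monomial q b =>
      rw [Polynomial.map_monomial, polyHom_monomial]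
      refine Eq.trans ?_ (Polynomial.eval₂_monomial _ _).symm
      rw [IsScalarTower.algebraMap_apply F C E, AlgHom.commutes]
      rfl
  v := S.basisElem T
  g := S.autE T σE hσE
  g_injective := S.autE_injective T σE hσE
  j_mul_v := S.polyHom_mul_basisElem T σE hσE
  bijective := ⟨S.comb_injective T σE hσE hu, S.comb_surjective T σE hσE hu⟩
  exists_mul_v l := by
    obtain ⟨e', he'⟩ := T.isUnit_e.pow (l.1 : ℕ)
    -- Multiplying e^k t^i on the left by t^{n-i} e^{-k} gives t^n = u x.
    refine ⟨S.t ^ (Module.finrank F C - l.2) * S.const (↑e'⁻¹ : A), Polynomial.monomial 1 u,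
      by simp [S.u_ne_zero T hu], ?_⟩
    rw [polyHom_monomial, hu, pow_one, ← t_pow_finrank, basisElem, ← he', mul_assoc,
      ← mul_assoc (S.const (↑e'⁻¹ : A)), ← map_mul, Units.inv_mul, map_one, one_mul, ← pow_add,
      Nat.sub_add_cancel l.2.2.le]
  eq_zero_of_mul_v l b h := by
    have h1 : b * S.const (T.e ^ (l.1 : ℕ)) = 0 := by
      refine S.ext_coeff fun i => ?_
      rw [← S.coeff_mul_t_pow _ (l.2 : ℕ), mul_assoc]
      exact congrArg (fun z => S.coeff z _) h
    exact (((T.isUnit_e.pow (l.1 : ℕ)).map S.const).mul_left_eq_zero).1 h1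
  card_eq := by
    rw [Fintype.card_prod, Fintype.card_fin, Fintype.card_fin, mul_comm,
      Module.finrank_mul_finrank]

/-- In each term of the Leibniz expansion the weights cancel, since a permutation preserves their
sum. What remains is n · deg ≤ (dn) · m. -/
theorem natDegree_det_le {K I : Type*} [CommRing K] [Fintype I] [DecidableEq I]
    (M : Matrix I I K[X]) (wt : I → ℕ) (n m d : ℕ) (hn : 0 < n) (hcard : Fintype.card I = d * n)
    (h : ∀ l k, M l k ≠ 0 → wt l + n * (M l k).natDegree ≤ m + wt k) :
    M.det.natDegree ≤ d * m := by
  rw [Matrix.det_apply]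
  refine Polynomial.natDegree_sum_le_of_forall_le _ _ fun π _ => ?_
  refine (Polynomial.natDegree_smul_le _ _).trans ?_
  by_cases h0 : ∀ k, M (π k) k ≠ 0
  · refine (Polynomial.natDegree_prod_le _ _).trans ?_
    have hsum := Finset.sum_le_sum fun k (_ : k ∈ Finset.univ) => h (π k) k (h0 k)
    rw [Finset.sum_add_distrib, Finset.sum_add_distrib, Equiv.sum_comp π wt, ← Finset.mul_sum,
      Finset.sum_const, Finset.card_univ, hcard, smul_eq_mul] at hsum
    refine le_of_mul_le_mul_left (a := n) ?_ hn
    calc _ ≤ d * n * m := by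
          have := hsum
          rw [add_comm (d * n * m)] at this
          exact Nat.le_of_add_le_add_left this
      _ = n * (d * m) := by ring
  · push Not at h0
    obtain ⟨k, hk⟩ := h0
    rw [Finset.prod_eq_zero (f := fun i => M (π i) i) (Finset.mem_univ k) hk]
    simp

variable [FiniteDimensional F E]

/-- Give e^k t^i the weight i and x the weight n. Left multiplication by `f` raises the t-degree by
at most `m`, and distinct basis terms cannot cancel, so every matrix entry obeys the weighted bound.
-/
theorem natDegree_nrm_le {f : S.SkewRing} {m : ℕ} (hm : ∀ i, m < i → S.coeff f i = 0) :
    ((S.crossedOrder T σE hσE hu).nrm f).natDegree ≤ Module.finrank C E * m := by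
  have hdet := (S.crossedOrder T σE hσE hu).algebraMap_nrm f
  rw [← Polynomial.natDegree_map (algebraMap F E)]
  change (algebraMap F[X] E[X] _).natDegree ≤ _
  rw [hdet]
  refine natDegree_det_le _ (fun l => (l.2 : ℕ)) (Module.finrank F C) m _ Module.finrank_pos
    (by simp) fun l k hlk => ?_
  by_contra! hlt
  refine hlk (Polynomial.leadingCoeff_eq_zero.1 ?_)
  refine S.coeff_eq_zero_of_comb T σE hσE hu
    (fun l => (S.crossedOrder T σE hσE hu).rho f l k) l.2 _ ?_ l.1
  have hmul := (S.crossedOrder T σE hσE hu).mul_v f k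
  change f * S.basisElem T k = ∑ l, S.basisElem T l * S.polyHom T _ at hmul
  rw [← hmul, basisElem, ← mul_assoc]
  obtain ⟨r, hr⟩ := Nat.exists_eq_add_of_lt hlt
  rw [hr, show m + (k.2 : ℕ) + r + 1 = (m + r + 1) + k.2 by omega, coeff_mul_t_pow,
    coeff_mul_const, hm _ (by omega), zero_mul]

end Order

/-! ### Minimal central left multiples and irreducibility -/

section Main

theorem IsMinCentralLeftMultiple.dvd {f : S.SkewRing} {h p : F[X]}
    (hh : S.IsMinCentralLeftMultiple f h) (hp : ∃ g, S.ofCenter p = g * f) : h ∣ p := by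
  obtain ⟨a, ha⟩ := hh.left_multiple
  obtain ⟨b, hb⟩ := hp
  rw [← Polynomial.modByMonic_eq_zero_iff_dvd hh.monic]
  by_contra h0
  have hmod : S.ofCenter (p %ₘ h) = (b - S.ofCenter (p /ₘ h) * a) * f := by
    rw [Polynomial.modByMonic_eq_sub_mul_div, mul_comm h, map_sub, map_mul, hb, ha, sub_mul,
      mul_assoc]
  have hle := hh.minimal (p %ₘ h * Polynomial.C (p %ₘ h).leadingCoeff⁻¹)
    (Polynomial.monic_mul_leadingCoeff_inv h0)
    ⟨S.ofCenter (Polynomial.C (p %ₘ h).leadingCoeff⁻¹) * (b - S.ofCenter (p /ₘ h) * a), by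
      rw [mul_comm, map_mul, hmod, mul_assoc]⟩
  rw [Polynomial.natDegree_mul_leadingCoeff_inv _ h0] at hle
  have hne : h ≠ 1 := by
    rintro rfl
    simp at h0
  exact absurd (Polynomial.natDegree_modByMonic_lt p hh.monic hne) (not_lt.2 hle)

/-- For h = pq, write Rf + Rp = Rg and f = f'g. If f' is a unit, then p lies in Rf. If g is a unit,
then multiplying g = bf + cp by the central q turns cp into ch, so q lies in Rf. Minimality gives h
| p or h | q. -/
theorem irreducible_of_irreducible [IsSimpleRing A] [IsArtinianRing A] {f : S.SkewRing}
    {h : F[X]} (hh : S.IsMinCentralLeftMultiple f h) (hf : Irreducible f) (hu : ¬ IsUnit h) :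
    Irreducible h := by
  refine ⟨hu, fun p q hpq => ?_⟩
  obtain ⟨a, ha⟩ := hh.left_multiple
  have h0 : p * q ≠ 0 := hpq ▸ hh.monic.ne_zero
  obtain ⟨g, hg, hgen⟩ := S.exists_generator
    (Submodule.span S.SkewRing {f, S.ofCenter p} : Ideal S.SkewRing)
  obtain ⟨f', hf'⟩ := hgen f (Submodule.subset_span (by simp))
  obtain ⟨p', hp'⟩ := hgen (S.ofCenter p) (Submodule.subset_span (by simp))
  rcases hf.isUnit_or_isUnit hf' with hu | hu
  · right
    obtain ⟨w, rfl⟩ := hu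
    have hdvd : h ∣ p := hh.dvd S ⟨p' * ↑w⁻¹, by
      rw [hf', mul_assoc, ← mul_assoc _ (w : S.SkewRing), Units.inv_mul, one_mul, hp']⟩
    rw [hpq, ← mul_one p, mul_assoc, one_mul] at hdvd
    exact isUnit_of_dvd_one ((mul_dvd_mul_iff_left (left_ne_zero_of_mul h0)).1 hdvd)
  · left
    obtain ⟨w, rfl⟩ := hu
    obtain ⟨b, c, hbc⟩ := Submodule.mem_span_pair.1 hg
    rw [smul_eq_mul, smul_eq_mul] at hbc
    have hdvd : h ∣ q := hh.dvd S ⟨↑w⁻¹ * (S.ofCenter q * b + c * a), by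
      rw [mul_assoc, add_mul, mul_assoc c, ← ha, hpq, map_mul, ← mul_assoc c,
        ((S.ofCenter_commute q (c * S.ofCenter p)).symm.eq : c * S.ofCenter p * S.ofCenter q = _),
        mul_assoc, ← mul_add, hbc, (S.ofCenter_commute q _).eq, ← mul_assoc, Units.inv_mul,
        one_mul]⟩
    rw [hpq, mul_comm, ← mul_one q, mul_assoc, one_mul] at hdvd
    exact isUnit_of_dvd_one ((mul_dvd_mul_iff_left (right_ne_zero_of_mul h0)).1 hdvd)

end Main

end TwistedData

theorem mainTheorem7 {F C E A : Type*} [Field F] [Field C] [Field E] [Ring A]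
    [Algebra F C] [Algebra C E] [Algebra C A]
    [FiniteDimensional F C] [IsGalois F C] [FiniteDimensional C E] [IsGalois C E]
    (T : CyclicAlgebra C E A) (S : TwistedData F C A)
    (σE : E ≃+* E) (hσE : ∀ z : E, S.σ (T.ι z) = T.ι (σE z))
    (hu : ∃ w : E, T.ι w = (S.u : A))
    (hcomm : ∀ z : E, T.γ (σE z) = σE (T.γ z))
    (f : S.SkewRing) (m : ℕ) (hm : S.HasDegree f m)
    (hft : S.RightCoprimeT f)
    (hhat : F[X]) (hhat_min : S.IsMinCentralLeftMultiple f hhat)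
    (hdeg : hhat.natDegree = Module.finrank C E * m) :
    (Irreducible hhat → Irreducible f) ∧
    (Irreducible f → ∃ p : F[X],
      S.norm f = algebraMap F[X] (FractionRing F[X]) p ∧ Irreducible p) := by
  obtain ⟨u, hu⟩ := hu
  have := T.isSimpleRing
  have := T.isArtinianRing
  let : Algebra F E := ((algebraMap C E).comp (algebraMap F C)).toAlgebra
  have : IsScalarTower F C E := .of_algebraMap_eq fun _ => rfl
  have : FiniteDimensional F E := FiniteDimensional.trans F C E
  let O := S.crossedOrder T σE hσE hu
  obtain ⟨g, hg⟩ := hhat_min.left_multiple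
  have hassoc : Associated hhat (O.nrm f) := by
    have hne : O.nrm f ≠ 0 := by
      intro h0
      have h1 := congrArg O.nrm hg
      rw [map_mul, h0, mul_zero] at h1
      -- The norm of the central element h is a power of h, so a vanishing norm of f would force h =
      -- 0.
      exact pow_ne_zero _ hhat_min.monic.ne_zero ((O.nrm_algebraMap hhat).symm.trans h1)
    obtain ⟨a, ha, -⟩ := O.exists_adjoint f
    have hdvd : hhat ∣ O.nrm f := hhat_min.dvd S ⟨a, ha.symm⟩
    -- The hypothesis deg h = dm meets the bound deg N(f) ≤ dm, so the divisibility is an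
    -- association.
    refine Polynomial.associated_of_dvd_of_natDegree_le hdvd hne ?_
    rw [hdeg]
    exact S.natDegree_nrm_le T σE hσE hu hm.2
  refine ⟨fun hirr => ?_, fun hirr => ⟨O.nrm f, O.reducedNorm_eq f, ?_⟩⟩
  · have hN := hassoc.irreducible hirr
    refine ⟨fun h => hN.not_isUnit ((O.isUnit_iff f).1 h), fun a b hab => ?_⟩
    rw [hab, map_mul] at hN
    rw [O.isUnit_iff, O.isUnit_iff]
    exact hN.isUnit_or_isUnit rfl
  · refine hassoc.irreducible (S.irreducible_of_irreducible hhat_min hirr fun h => ?_)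
    exact hirr.not_isUnit ((O.isUnit_iff f).2 (hassoc.isUnit h))
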